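/- For positive integers $m,n$ let $\mathbf m\times\mathbf n$ be the product, with the componentwise order, of a chain with $m$ elements and a chain with $n$ elements. Let $\mathrm{inc}(\mathbf m\times\mathbf 3)$ be the incomparability graph of $\mathbf m\times\mathbf 3$: its vertices are the elements of the poset, and two vertices are adjacent iff they are incomparable. Let $H_m$ be the graph obtained from $\mathrm{inc}(\mathbf m\times\mathbf 3)$ by removing the minimum and the maximum of $\mathbf m\times\mathbf 3$. For a finite graph $G$ and a sequence $\tau=(\tau_1,\dots,\tau_l)$ of positive integers with sum $|V(G)|$, let $\mathrm{stc}(G;\tau)$ be the number of sequences $(B_1,\dots,B_l)$ of pairwise disjoint sets with union $V(G)$ such that each $B_i$ is a stable (independent) set of $G$ with $|B_i|=\tau_i$. A partition $\lambda$ of $N$ dominates a partition $\mu$ of $N$, written $\lambda\ge\mu$, if $\lambda_1+\dots+\lambda_k\ge\mu_1+\dots+\mu_k$ for all $k$, where parts are listed in weakly decreasing order and missing parts count as $0$. The graph $G$ is strongly nice if $\mathrm{stc}(G;\lambda)\le\mathrm{stc}(G;\mu)$ for all partitions $\lambda\ge\mu$ of $|V(G)|$. **Theorem.** For every integer $m\ge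 44$, neither $\mathrm{inc}(\mathbf m\times\mathbf 3)$ nor $H_m$ is strongly nice. Moreover, with $$\lambda=(m+2,\,m-2,\,m-4,\,4),\quad \lambda^-=(m,\,m-2,\,m-4,\,4),\quad \mu=(m+2,\,m-3,\,m-3,\,4),\quad \mu^-=(m,\,m-3,\,m-3,\,4),$$ we have $$\mathrm{stc}(\mathrm{inc}(\mathbf m\times\mathbf 3);\lambda)=\mathrm{stc}(H_m;\lambda^-)=m^4-\tfrac{25}{3}m^3+36m^2-\tfrac{194}{3}m+144,$$ $$\mathrm{stc}(\mathrm{inc}(\mathbf m\times\mathbf 3);\mu)=\mathrm{stc}(H_m;\mu^-)=m^4-\tfrac{26}{3}m^3+52m^2-\tfrac{379}{3}m+240.$$ In particular $\mathrm{stc}(\mathrm{inc}(\mathbf m\times\mathbf 3);\lambda)>\mathrm{stc}(\mathrm{inc}(\mathbf m\times\mathbf 3);\mu)$ and $\mathrm{stc}(H_m;\lambda^-)>\mathrm{stc}(H_m;\mu^-)$, although $\lambda$ and $\mu$ are partitions of $3m$ with $\lambda\ge\mu$ and $\lambda\ne\mu$, and $\lambda^-$ and $\mu^-$ are partitions of $3m-2$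 with $\lambda^-\ge\mu^-$ and $\lambda^-\ne\mu^-$. -/

import Mathlib

/-- The incomparability graph of a poset: two elements are adjacent iff they are incomparable. -/
def incGraph (P : Type*) [PartialOrder P] : SimpleGraph P where
  Adj a b := IncompRel (· ≤ ·) a b
  symm := ⟨fun _ _ h => ⟨h.2, h.1⟩⟩
  loopless := ⟨fun _ h => h.1 le_rfl⟩

/-- The incomparability graph of the product (with the componentwise order) of the chain with `m`
elements and the chain with `n` elements. -/
def incChainProd (m n : ℕ) : SimpleGraph (Fin m × Fin n) :=
  incGraph (Fin m × Fin n)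

/-- The elements of the product of two chains other than its minimum and its maximum. -/
abbrev InnerVertex (m n : ℕ) : Type :=
  {v : Fin m × Fin n // ¬ IsBot v ∧ ¬ IsTop v}

/-- The graph obtained from the incomparability graph of the product of two chains by removing
the minimum and the maximum. -/
def innerGraph (m n : ℕ) : SimpleGraph (InnerVertex m n) :=
  (incChainProd m n).induce {v | ¬ IsBot v ∧ ¬ IsTop v}

/-- The stable compositions of `G` of type `τ = (τ₁, …, τ_l)`: sequences `(B₁, …, B_l)` of stable
blocks, with `B_i` of size `τ_i`, such that every vertex lies in exactly one block. -/
def stableCompositions {V : Type*} (G : SimpleGraph V) (τ : List ℕ) :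
    Set (Fin τ.length → Finset V) :=
  {B | (∀ v, ∃! i, v ∈ B i) ∧ ∀ i, G.IsIndepSet (B i : Set V) ∧ (B i).card = τ.get i}

/-- The number of stable compositions of type `τ` of a finite graph. -/
noncomputable def stc {V : Type*} (G : SimpleGraph V) (τ : List ℕ) : ℕ :=
  (stableCompositions G τ).ncard

/-- The parts of an integer partition, listed in weakly decreasing order. -/
def partsList {n : ℕ} (p : n.Partition) : List ℕ :=
  p.parts.sort (· ≥ ·)

/-- The dominance order: `p` dominates `q` if, for all `k`, the sum of the `k` largest parts of
`p` is at least that of `q` (missing parts count as zero). -/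
def Dominates {n : ℕ} (p q : n.Partition) : Prop :=
  ∀ k : ℕ, ((partsList q).take k).sum ≤ ((partsList p).take k).sum

/-- A finite graph is strongly nice if `stc G p ≤ stc G q` for all integer partitions `p`, `q` of
its order such that `p` dominates `q`. -/
def StronglyNice {V : Type*} [Finite V] (G : SimpleGraph V) : Prop :=
  ∀ p q : (Nat.card V).Partition, Dominates p q → stc G (partsList p) ≤ stc G (partsList q)

/-! Stable sets of the incomparability graph are chains, so a stable composition with four blocks is
a colouring of the `m` columns by four colours whose classes are chains. Reading columns from left
to right, it suffices to remember the row each colour has reached and how far its size falls short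
of a reference: `n + 2`, the size of a maximal chain, for three colours, and `4` for the last. The
types `λ` and `μ` become the shortfalls `(0, 4, 6, 0)` and `(0, 5, 5, 0)`, which do not depend on
`m`, so both counts obey one transfer recursion (`scanCount_succ`).

In this recursion a column either raises the total row of the first three colours, which is at most
6, or spends the fourth colour, available four times, or leaves the state unchanged. An unchanged
state requires the first three colours to occupy the three rows bijectively, and then the column is
forced. Only the fourth colour leads from one such state to another, so a path meets at most five of
them. Each costs one difference operator, hence from `n = 11` on the counts are polynomials of
degree at most 4 (`evPoly_scanCount`). Five values, computed by running the recursion in the kernel,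
determine each polynomial.

The first block has the size of a maximal chain, hence contains the minimum and the maximum.
Deleting these gives the same counts for the inner graph (`stc_innerGraph`). -/

open Finset

/-! ### Colourings by chains, read column by column -/

/-- The number of cells of colour `k` in a column. -/
def colMult (a : Fin 3 → Fin 4) (k : Fin 4) : ℕ := #{j | a j = k}

/-- The rows reached by the colour classes after reading the column `a`. -/
def raiseRows (s : Fin 4 → Fin 3) (a : Fin 3 → Fin 4) : Fin 4 → Fin 3 :=
  Function.update (Function.update (Function.update s (a 0) 0) (a 1) 1) (a 2) 2

/-- The column `a` may follow columns after which the colour classes have reached the rows `s`. -/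
def FitsRows (s : Fin 4 → Fin 3) (a : Fin 3 → Fin 4) : Prop := ∀ j, s (a j) ≤ j

instance (s : Fin 4 → Fin 3) (a : Fin 3 → Fin 4) : Decidable (FitsRows s a) :=
  inferInstanceAs (Decidable (∀ j, s (a j) ≤ j))

/-- Each colour class is a chain. -/
def ChainClasses {n : ℕ} (c : Fin n → Fin 3 → Fin 4) : Prop :=
  ∀ x y, x < y → ∀ i j, c x i = c y j → i ≤ j

def classSize {n : ℕ} (c : Fin n → Fin 3 → Fin 4) (k : Fin 4) : ℕ := ∑ x, colMult (c x) k

/-- The growth per column of the reference size of the colour classes. -/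
def unitQuota (k : Fin 4) : ℕ := if k = 3 then 0 else 1

/-- The reference sizes of the colour classes on `n` columns. -/
def quota (n : ℕ) (k : Fin 4) : ℕ := if k = 3 then 4 else n + 2

/-- Colourings of `n` columns by chains that continue from the rows `s`, and in which the size of
the class `k` falls short of the reference size by `x k`. -/
def IsScanColoring {n : ℕ} (s : Fin 4 → Fin 3) (x : Fin 4 → ℕ) (c : Fin n → Fin 3 → Fin 4) :
    Prop :=
  ChainClasses c ∧ (∀ i, FitsRows s (c i)) ∧ ∀ k, classSize c k + x k = quota n k

open Classical in
/-- The number of scan colourings. -/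
noncomputable def scanCount (n : ℕ) (s : Fin 4 → Fin 3) (x : Fin 4 → ℕ) : ℕ :=
  ∑ c : Fin n → Fin 3 → Fin 4, if IsScanColoring s x c then 1 else 0

/-- A necessary condition on the shortfalls after a column for a colouring to exist. -/
def Feasible (s : Fin 4 → Fin 3) (y : Fin 4 → ℕ) : Prop :=
  ∀ k, if k = 3 then y k ≤ 4 else (s k : ℕ) < y k

instance (s : Fin 4 → Fin 3) (y : Fin 4 → ℕ) : Decidable (Feasible s y) :=
  inferInstanceAs (Decidable (∀ k, if k = 3 then y k ≤ 4 else (s k : ℕ) < y k))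

/-- The last update wins, so a colour ends at its highest cell in the column. `FitsRows` guarantees
that overwriting never lowers a row. -/
theorem raiseRows_le_iff {s : Fin 4 → Fin 3} {a : Fin 3 → Fin 4} (h : FitsRows s a) (k : Fin 4)
    (j : Fin 3) : raiseRows s a k ≤ j ↔ s k ≤ j ∧ ∀ i, a i = k → i ≤ j := by
  have h0 := h 0
  have h1 := h 1
  have h2 := h 2
  simp only [raiseRows, Function.update_apply, Fin.forall_fin_succ, Fin.forall_fin_zero] at *
  have e1 : (Fin.succ 0 : Fin 3) = 1 := rfl
  simp only [Fin.succ_zero_eq_one, Fin.succ_one_eq_two, e1, eq_comm (a := k)]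
  split_ifs <;> subst_vars <;> simp_all <;> omega

/-- Within the column the class only uses rows between its old row and its new one. Over all columns
this telescopes to `classSize_add_le`, the bound on the size of a chain starting at a given row. -/
theorem colMult_add_le (s : Fin 4 → Fin 3) (a : Fin 3 → Fin 4) (h : FitsRows s a) (k : Fin 4) :
    colMult a k + s k ≤ raiseRows s a k + 1 := by
  have h0 := h 0
  have h1 := h 1
  have h2 := h 2
  have hm : colMult a k = (if a 0 = k then 1 else 0) + (if a 1 = k then 1 else 0)
      + (if a 2 = k then 1 else 0) := by
    rw [colMult, Finset.card_filter, Fin.sum_univ_three]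
  rw [hm]
  simp only [raiseRows, Function.update_apply, eq_comm (a := k)]
  split_ifs <;> subst_vars <;> simp_all [Fin.le_def] <;> omega

theorem chainClasses_cons {n : ℕ} (a : Fin 3 → Fin 4) (c : Fin n → Fin 3 → Fin 4) :
    ChainClasses (Fin.cons a c : Fin (n + 1) → Fin 3 → Fin 4) ↔
      ChainClasses c ∧ ∀ x i j, a i = c x j → i ≤ j := by
  simp [ChainClasses, Fin.forall_fin_succ (n := n)]
  exact and_comm

theorem classSize_cons {n : ℕ} (a : Fin 3 → Fin 4) (c : Fin n → Fin 3 → Fin 4) (k : Fin 4) :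
    classSize (Fin.cons a c : Fin (n + 1) → Fin 3 → Fin 4) k = colMult a k + classSize c k := by
  simp [classSize, Fin.sum_univ_succ]

theorem fitsRows_raiseRows_iff {s : Fin 4 → Fin 3} {a : Fin 3 → Fin 4} (h : FitsRows s a)
    (b : Fin 3 → Fin 4) :
    FitsRows (raiseRows s a) b ↔ FitsRows s b ∧ ∀ i j, a i = b j → i ≤ j := by
  simp only [FitsRows, raiseRows_le_iff h, forall_and]
  exact and_congr_right fun _ => forall_comm

theorem classSize_add_le {n : ℕ} (c : Fin n → Fin 3 → Fin 4) (k : Fin 4) :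
    ∀ s : Fin 4 → Fin 3, ChainClasses c → (∀ i, FitsRows s (c i)) →
      classSize c k + s k ≤ n + 2 := by
  induction n with
  | zero => intro s _ _; simp [classSize]; omega
  | succ n ih =>
    intro s hc hs
    obtain ⟨a, c, rfl⟩ : ∃ a c', c = Fin.cons a c' := ⟨c 0, Fin.tail c, (Fin.cons_self_tail c).symm⟩
    have ha : FitsRows s a := by simpa using hs 0
    rw [chainClasses_cons] at hc
    have := ih c (raiseRows s a) hc.1 fun i => (fitsRows_raiseRows_iff ha _).2
      ⟨by simpa using hs i.succ, hc.2 i⟩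
    have := colMult_add_le s a ha k
    rw [classSize_cons]
    omega

/-- Feasibility costs nothing, since `classSize_add_le` forces it. It keeps the reachable states few
and makes the truncated subtraction of `unitQuota` exact. -/
theorem isScanColoring_cons {n : ℕ} (s : Fin 4 → Fin 3) (x : Fin 4 → ℕ) (a : Fin 3 → Fin 4)
    (c : Fin n → Fin 3 → Fin 4) :
    IsScanColoring s x (Fin.cons a c : Fin (n + 1) → Fin 3 → Fin 4) ↔
      (FitsRows s a ∧ Feasible (raiseRows s a) (fun k => x k + colMult a k)) ∧
      IsScanColoring (raiseRows s a) (fun k => x k + colMult a k - unitQuota k) c := by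
  by_cases ha : FitsRows s a
  swap
  · exact iff_of_false (fun h => ha (by simpa using h.2.1 0)) fun h => ha h.1.1
  simp only [IsScanColoring, chainClasses_cons, ha, true_and, fitsRows_raiseRows_iff ha,
    Fin.forall_fin_succ (n := n), Fin.cons_zero, Fin.cons_succ, classSize_cons, forall_and]
  constructor
  · rintro ⟨⟨h1, h2⟩, h3, h4⟩
    have hb := fun k => classSize_add_le c k (raiseRows s a) h1 fun i =>
      (fitsRows_raiseRows_iff ha _).2 ⟨h3 i, h2 i⟩
    refine ⟨fun k => ?_, h1, ⟨h3, h2⟩, fun k => ?_⟩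
    all_goals
      have := hb k
      have := h4 k
      simp only [quota, unitQuota] at *
      split_ifs at * <;> omega
  · rintro ⟨h0, h1, ⟨h3, h2⟩, h4⟩
    refine ⟨⟨h1, h2⟩, h3, fun k => ?_⟩
    have := h0 k
    have := h4 k
    simp only [quota, unitQuota] at *
    split_ifs at * <;> omega

open Classical in
theorem scanCount_succ (n : ℕ) (s : Fin 4 → Fin 3) (x : Fin 4 → ℕ) :
    scanCount (n + 1) s x = ∑ a : Fin 3 → Fin 4,
      if FitsRows s a ∧ Feasible (raiseRows s a) (fun k => x k + colMult a k) then
        scanCount n (raiseRows s a) (fun k => x k + colMult a k - unitQuota k) else 0 := by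
  rw [scanCount, ← (Fin.consEquiv fun _ : Fin (n + 1) => Fin 3 → Fin 4).sum_comp,
    Fintype.sum_prod_type]
  refine Finset.sum_congr rfl fun a _ => ?_
  rw [scanCount]
  split_ifs with h
  · exact Finset.sum_congr rfl fun c _ => if_congr
      ((isScanColoring_cons s x a c).trans (and_iff_right h)) rfl rfl
  · exact Finset.sum_eq_zero fun c _ => if_neg fun h' => h ((isScanColoring_cons s x a c).1 h').1

theorem scanCount_zero (s : Fin 4 → Fin 3) (x : Fin 4 → ℕ) :
    scanCount 0 s x = if x = quota 0 then 1 else 0 := by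
  simp [scanCount, IsScanColoring, ChainClasses, classSize, funext_iff]

/-! ### Eventually polynomial sequences -/

/-- From `T` on, `f` is annihilated by the `D`-th power of the forward difference operator. -/
def EvPoly : ℕ → ℕ → (ℕ → ℤ) → Prop
  | 0, T, f => ∀ n ≥ T, f n = 0
  | D + 1, T, f => EvPoly D T fun n => f (n + 1) - f n

namespace EvPoly

theorem zero (D T : ℕ) : EvPoly D T fun _ => 0 := by
  induction D with
  | zero => exact fun _ _ => rfl
  | succ D ih => simpa [EvPoly] using ih

theorem mono_start {D T T' : ℕ} {f : ℕ → ℤ} (h : EvPoly D T f) (hT : T ≤ T') :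
    EvPoly D T' f := by
  induction D generalizing f with
  | zero => exact fun n hn => h n (hT.trans hn)
  | succ D ih => exact ih h

theorem succ {D T : ℕ} {f : ℕ → ℤ} (h : EvPoly D T f) : EvPoly (D + 1) T f := by
  induction D generalizing f with
  | zero => exact fun n hn => by simp [h n hn, h (n + 1) (Nat.le_succ_of_le hn)]
  | succ D ih => exact ih h

theorem mono_order {D D' T : ℕ} {f : ℕ → ℤ} (h : EvPoly D T f) (hD : D ≤ D') :
    EvPoly D' T f := by
  induction hD with
  | refl => exact h
  | step _ ih => exact ih.succ

theorem add {D T : ℕ} {f g : ℕ → ℤ} (hf : EvPoly D T f) (hg : EvPoly D T g) :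
    EvPoly D T fun n => f n + g n := by
  induction D generalizing f g with
  | zero => exact fun n hn => by simp [hf n hn, hg n hn]
  | succ D ih =>
    have := ih hf hg
    simpa only [EvPoly, add_sub_add_comm] using this

theorem sum {ι : Type*} {D T : ℕ} {f : ι → ℕ → ℤ} (s : Finset ι)
    (h : ∀ i ∈ s, EvPoly D T (f i)) : EvPoly D T fun n => ∑ i ∈ s, f i n := by
  classical
  induction s using Finset.induction_on with
  | empty => simpa using zero D T
  | insert i s hi ih =>
    simp only [Finset.sum_insert hi]
    exact (h i (by simp)).add (ih fun j hj => h j (by simp [hj]))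

theorem const_mul {D T : ℕ} {f : ℕ → ℤ} (a : ℤ) (hf : EvPoly D T f) :
    EvPoly D T fun n => a * f n := by
  induction D generalizing f with
  | zero => exact fun n hn => by simp [hf n hn]
  | succ D ih =>
    have := ih hf
    simpa only [EvPoly, mul_sub] using this

theorem of_shift {D T : ℕ} {f g : ℕ → ℤ} (hg : EvPoly D T g) (h : ∀ n, f (n + 1) = g n) :
    EvPoly D (T + 1) f := by
  induction D generalizing f g with
  | zero =>
    intro n hn
    obtain ⟨n, rfl⟩ := Nat.exists_eq_succ_of_ne_zero (by omega : n ≠ 0)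
    rw [Nat.succ_eq_add_one, h, hg n (by omega)]
  | succ D ih => exact ih hg fun n => by simp only [h]

theorem eq_zero {D T : ℕ} {f : ℕ → ℤ} (hf : EvPoly D T f) (h : ∀ i < D, f (T + i) = 0) :
    ∀ n ≥ T, f n = 0 := by
  induction D generalizing f with
  | zero => exact hf
  | succ D ih =>
    have hd := ih hf fun i hi => by
      rw [add_assoc, h (i + 1) (by omega), h i (by omega), sub_zero]
    refine Nat.le_induction (h 0 (by omega)) fun n hn hn0 => ?_
    have := hd n hn
    omega

end EvPoly

/-! ### Polynomiality of the scan counts -/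

/-- The total of the rows reached by the first three colours. -/
def rowSum (s : Fin 4 → Fin 3) : ℕ := s 0 + s 1 + s 2

/-- Reading the column `a` changes neither the rows `s` nor the shortfalls. -/
def IsLoop (s : Fin 4 → Fin 3) (a : Fin 3 → Fin 4) : Prop :=
  (∀ k, colMult a k = unitQuota k) ∧ raiseRows s a = s

instance (s : Fin 4 → Fin 3) (a : Fin 3 → Fin 4) : Decidable (IsLoop s a) :=
  inferInstanceAs (Decidable (_ ∧ _))

/-- If the fourth colour is absent and no row rises, every cell lies in the row its colour had
already reached. The three cells then carry three distinct colours, which is a loop. -/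
theorem isLoop_or_progress : ∀ (s : Fin 4 → Fin 3) (a : Fin 3 → Fin 4), FitsRows s a →
    rowSum s < rowSum (raiseRows s a) ∨ IsLoop s a ∨
      rowSum s = rowSum (raiseRows s a) ∧ 0 < colMult a 3 := by
  decide +kernel

theorem eq_iff_of_isLoop : ∀ (s : Fin 4 → Fin 3) (a : Fin 3 → Fin 4), FitsRows s a →
    IsLoop s a → rowSum s = 3 ∧ ∀ j k, a j = k ↔ k ≠ 3 ∧ s k = j := by
  decide +kernel

theorem rowSum_le (s : Fin 4 → Fin 3) : rowSum s ≤ 6 := by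
  unfold rowSum
  omega

/-- `N` bounds the number of non-loop columns still possible. The order bounds the number of loop
states still to be met: these have row total 3, and two different ones on a path differ in `x 3`.
Beyond row total 3 no loop remains, so the count eventually vanishes. -/
theorem evPoly_scanCount (N : ℕ) : ∀ (s : Fin 4 → Fin 3) (x : Fin 4 → ℕ), x 3 ≤ 4 →
    4 - x 3 + (6 - rowSum s) ≤ N →
    EvPoly (if rowSum s ≤ 3 then 5 - x 3 else 0) (N + 1) fun n => (scanCount n s x : ℤ) := by
  induction N using Nat.strong_induction_on with
  | _ N ih =>
  intro s x hx hN
  let A (a : Fin 3 → Fin 4) : Prop :=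
    FitsRows s a ∧ Feasible (raiseRows s a) (fun k => x k + colMult a k)
  let g (a : Fin 3 → Fin 4) (n : ℕ) : ℤ := if A a then
    (scanCount n (raiseRows s a) (fun k => x k + colMult a k - unitQuota k) : ℤ) else 0
  have hrec : ∀ n, (scanCount (n + 1) s x : ℤ) = ∑ a, g a n := fun n => by
    rw [scanCount_succ]
    push_cast
    exact Finset.sum_congr rfl fun a _ => by congr
  -- From row total 3, a non-loop column either leaves the loop level or increases `x 3`; in both
  -- cases the order drops by at least one.
  have hg : ∀ a, (A a → ¬ IsLoop s a) → EvPoly (if rowSum s ≤ 3 then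
      (if rowSum s = 3 then 4 - x 3 else 5 - x 3) else 0) N (g a) := by
    intro a hl
    by_cases hA : A a
    swap
    · simpa only [g, if_neg hA] using EvPoly.zero _ _
    simp only [g, if_pos hA]
    have h3 : x 3 + colMult a 3 ≤ 4 := by simpa using hA.2 3
    have hu : unitQuota 3 = 0 := rfl
    have hp := isLoop_or_progress s a hA.1
    have hr := rowSum_le (raiseRows s a)
    have hl := hl hA
    refine ((ih (4 - (x 3 + colMult a 3) + (6 - rowSum (raiseRows s a))) (by grind) _ _
      (by simpa [hu] using h3) (by simp [hu])).mono_start (by grind)).mono_order ?_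
    rw [hu]
    split_ifs <;> grind
  by_cases hloop : ∃ a, A a ∧ IsLoop s a
  · obtain ⟨a, hA, hl⟩ := hloop
    obtain ⟨h3, ha⟩ := eq_iff_of_isLoop s a hA.1 hl
    rw [if_pos h3.le, (by omega : 5 - x 3 = 4 - x 3 + 1)]
    have hga : ∀ n, g a n = scanCount n s x := fun n => by
      simp only [g, if_pos hA, hl.1, hl.2, Nat.add_sub_cancel]
    have hsum := EvPoly.sum (univ.erase a) fun b hb => hg b fun hB hlb =>
      (Finset.mem_erase.1 hb).1 (funext fun j =>
        ((eq_iff_of_isLoop s b hB.1 hlb).2 j (a j)).2 ((ha j (a j)).1 rfl))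
    simp only [h3, if_true, le_refl] at hsum
    refine EvPoly.mono_start (T := N) ?_ (by omega)
    -- The loop column contributes the count of the same state on `n` columns, so the first
    -- difference is the sum over the other columns.
    simp only [EvPoly, hrec]
    convert hsum using 2 with n
    rw [← Finset.add_sum_erase _ _ (Finset.mem_univ a), hga]
    ring
  · refine EvPoly.of_shift ((EvPoly.sum univ fun a _ => hg a fun hA hl =>
      hloop ⟨a, hA, hl⟩).mono_order ?_) hrec
    split_ifs <;> omega

/-! ### Kernel computation of the first values -/

/-- The rows and shortfalls of the four colour classes. -/
structure ScanState where
  s0 : Fin 3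
  s1 : Fin 3
  s2 : Fin 3
  s3 : Fin 3
  x0 : ℕ
  x1 : ℕ
  x2 : ℕ
  x3 : ℕ

/-- A list of states with multiplicities and keys. -/
inductive Bucket where
  | nil : Bucket
  | cons (h : ℕ) (q : ScanState) (c : ℕ) (b : Bucket) : Bucket

/-- A multiset of states, arranged by the keys. -/
inductive Trie where
  | nil : Trie
  | leaf (b : Bucket) : Trie
  | node (l r : Trie) : Trie

/-- Evaluates a natural number before passing it on. -/
def force (n : ℕ) (k : ℕ → Bool) : Bool :=
  Nat.rec (k 0) (fun i _ => k (Nat.succ i)) n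

theorem force_eq (n : ℕ) (k : ℕ → Bool) : force n k = k n := by
  cases n <;> rfl

/-- Branches on `b`. -/
def branchOn (b u v : Bool) : Bool := Bool.rec v u b

theorem branchOn_eq_true {b u v : Bool} :
    branchOn b u v = true ↔ b = true ∧ u = true ∨ ¬ b = true ∧ v = true := by
  cases b <;> simp [branchOn]

namespace ScanState

def rows (q : ScanState) : Fin 4 → Fin 3 := ![q.s0, q.s1, q.s2, q.s3]

def shortfalls (q : ScanState) : Fin 4 → ℕ := ![q.x0, q.x1, q.x2, q.x3]

def same (p q : ScanState) : Bool :=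
  Nat.beq p.x0 q.x0 && (Nat.beq p.x1 q.x1 && (Nat.beq p.x2 q.x2 && (Nat.beq p.x3 q.x3 &&
  (Nat.beq p.s0.val q.s0.val && (Nat.beq p.s1.val q.s1.val && (Nat.beq p.s2.val q.s2.val &&
    Nat.beq p.s3.val q.s3.val))))))

theorem eq_of_same {p q : ScanState} (h : same p q = true) : p = q := by
  cases p
  cases q
  simp only [same, Bool.and_eq_true, Nat.beq_eq] at h
  simp only [mk.injEq, Fin.ext_iff]
  tauto

/-- Injectivity is never needed: the key only chooses a place in the trie, through the six bits of
its residue modulo `61 < 2 ^ 6`, and screens comparisons. States are merged only after `same`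
succeeds. -/
def key (q : ScanState) : ℕ :=
  Nat.add q.s0.val (Nat.mul 3 (Nat.add q.s1.val (Nat.mul 3 (Nat.add q.s2.val (Nat.mul 3
    (Nat.add q.s3.val (Nat.mul 3 (Nat.add q.x0 (Nat.mul 16 (Nat.add q.x1 (Nat.mul 16
      (Nat.add q.x2 (Nat.mul 16 q.x3)))))))))))))

/-- Colour `k` is put into row `j`. -/
def put (j : Fin 3) (k : Fin 4) (p : (Fin 4 → Fin 3) × (Fin 4 → ℕ)) :
    (Fin 4 → Fin 3) × (Fin 4 → ℕ) :=
  (Function.update p.1 k j, Function.update p.2 k (p.2 k + 1))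

theorem put_snd (j : Fin 3) (k i : Fin 4) (p : (Fin 4 → Fin 3) × (Fin 4 → ℕ)) :
    (put j k p).2 i = p.2 i + if k = i then 1 else 0 := by
  simp only [put, Function.update_apply, eq_comm (a := i)]
  split_ifs with h
  · rw [h]
  · rfl

def toPair (q : ScanState) : (Fin 4 → Fin 3) × (Fin 4 → ℕ) := (q.rows, q.shortfalls)

end ScanState

def Bucket.weight (f : ScanState → ℕ) : Bucket → ℕ
  | nil => 0
  | cons _ q c b => c * f q + b.weight f

namespace Trie

def weight (f : ScanState → ℕ) : Trie → ℕ
  | nil => 0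
  | leaf b => b.weight f
  | node l r => l.weight f + r.weight f

/-- Insertion into a bucket, in continuation passing style. -/
noncomputable def addTo (q : ScanState) (c h : ℕ) (b : Bucket) : (Bucket → Bool) → Bool :=
  Bucket.rec (fun k => k (.cons h q c .nil))
    (fun h' q' c' b ih k => branchOn (Nat.beq h h')
      (branchOn (ScanState.same q q') (force (Nat.add c' c) fun c' => k (.cons h' q' c' b))
        (ih fun b' => k (.cons h' q' c' b')))
      (ih fun b' => k (.cons h' q' c' b'))) b

theorem addTo_cons (q : ScanState) (c h h' : ℕ) (q' : ScanState) (c' : ℕ) (b : Bucket)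
    (k : Bucket → Bool) : addTo q c h (.cons h' q' c' b) k = branchOn (Nat.beq h h')
      (branchOn (ScanState.same q q') (force (Nat.add c' c) fun c' => k (.cons h' q' c' b))
        (addTo q c h b fun b' => k (.cons h' q' c' b')))
      (addTo q c h b fun b' => k (.cons h' q' c' b')) := rfl

/-- Only soundness is required: if the whole computation returns `true`, the continuation was run on
a bucket of the right weight. A state left unmerged does no harm, because weights are additive. -/
theorem addTo_spec (q : ScanState) (c h : ℕ) (b : Bucket) :
    ∀ k, addTo q c h b k = true →
      ∃ b', (∀ f, b'.weight f = b.weight f + c * f q) ∧ k b' = true := by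
  induction b with
  | nil => exact fun k hk => ⟨_, fun f => by simp [Bucket.weight], hk⟩
  | cons h' q' c' b ih =>
    intro k hk
    have key : (addTo q c h b fun b' => k (.cons h' q' c' b')) = true →
        ∃ b', (∀ f, b'.weight f = (Bucket.cons h' q' c' b).weight f + c * f q) ∧ k b' = true := by
      intro hk
      obtain ⟨b', hb, hk⟩ := ih _ hk
      exact ⟨_, fun f => by simp only [Bucket.weight, hb, add_assoc], hk⟩
    rw [addTo_cons, branchOn_eq_true, branchOn_eq_true, force_eq] at hk
    obtain ⟨-, ⟨hs, hk⟩ | ⟨-, hk⟩⟩ | ⟨-, hk⟩ := hk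
    · rw [ScanState.eq_of_same hs]
      refine ⟨_, fun f => ?_, hk⟩
      simp only [Bucket.weight, Nat.add_eq, add_mul]
      ring
    · exact key hk
    · exact key hk

/-- Insertion into a trie of depth `d`, in continuation passing style. -/
noncomputable def ins (q : ScanState) (c h d : ℕ) : Trie → (Trie → Bool) → Bool :=
  Nat.rec
    (fun t k => Trie.rec (k (leaf (.cons h q c .nil)))
      (fun b => addTo q c h b fun b' => k (leaf b')) (fun _ _ _ _ => false) t)
    (fun i ih t k => branchOn (Nat.beq (Nat.land (Nat.shiftRight (Nat.mod h 61) i) 1) 1)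
      (Trie.rec (ih nil fun t => k (node nil t)) (fun _ => false)
        (fun l r _ _ => ih r fun t => k (node l t)) t)
      (Trie.rec (ih nil fun t => k (node t nil)) (fun _ => false)
        (fun l r _ _ => ih l fun t => k (node t r)) t)) d

theorem ins_succ_nil (q : ScanState) (c h d : ℕ) (k : Trie → Bool) :
    ins q c h (d + 1) nil k =
      branchOn (Nat.beq (Nat.land (Nat.shiftRight (Nat.mod h 61) d) 1) 1)
        (ins q c h d nil fun t => k (node nil t)) (ins q c h d nil fun t => k (node t nil)) := rfl

theorem ins_succ_leaf (q : ScanState) (c h d : ℕ) (b : Bucket) (k : Trie → Bool) :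
    ins q c h (d + 1) (leaf b) k =
      branchOn (Nat.beq (Nat.land (Nat.shiftRight (Nat.mod h 61) d) 1) 1) false false := rfl

theorem ins_succ_node (q : ScanState) (c h d : ℕ) (l r : Trie) (k : Trie → Bool) :
    ins q c h (d + 1) (node l r) k =
      branchOn (Nat.beq (Nat.land (Nat.shiftRight (Nat.mod h 61) d) 1) 1)
        (ins q c h d r fun t => k (node l t)) (ins q c h d l fun t => k (node t r)) := rfl

theorem ins_spec (q : ScanState) (c h d : ℕ) :
    ∀ t k, ins q c h d t k = true →
      ∃ t', (∀ f, t'.weight f = t.weight f + c * f q) ∧ k t' = true := by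
  induction d with
  | zero =>
    intro t k hk
    cases t with
    | nil => exact ⟨_, fun f => by simp [weight, Bucket.weight], hk⟩
    | leaf b =>
      obtain ⟨b', hb, hk⟩ := addTo_spec q c h b _ hk
      exact ⟨leaf b', hb, hk⟩
    | node l r => exact absurd hk Bool.false_ne_true
  | succ i ih =>
    intro t k hk
    cases t with
    | nil =>
      rw [ins_succ_nil, branchOn_eq_true] at hk
      obtain ⟨-, hk⟩ | ⟨-, hk⟩ := hk
      all_goals
        obtain ⟨t', ht, hk⟩ := ih _ _ hk
        exact ⟨_, fun f => by simp [weight, ht], hk⟩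
    | leaf b => simp [ins_succ_leaf, branchOn_eq_true] at hk
    | node l r =>
      rw [ins_succ_node, branchOn_eq_true] at hk
      obtain ⟨-, hk⟩ | ⟨-, hk⟩ := hk
      all_goals
        obtain ⟨t', ht, hk⟩ := ih _ _ hk
        exact ⟨_, fun f => by simp only [weight, ht]; ring, hk⟩

/-- Continues with `f` before `k` if row `i` is at most row `j`. -/
def ifLe (i j : Fin 3) (f : Trie → (Trie → Bool) → Bool) (t : Trie) (k : Trie → Bool) : Bool :=
  branchOn (Nat.ble i.val j.val) (f t k) (k t)

/-- Puts each admissible colour into row `j` and continues with `g`. -/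
noncomputable def place (j : Fin 3) (g : ScanState → Trie → (Trie → Bool) → Bool)
    (q : ScanState) (t : Trie) (k : Trie → Bool) : Bool :=
  ScanState.rec (fun s0 s1 s2 s3 x0 x1 x2 x3 =>
    ifLe s0 j (g ⟨j, s1, s2, s3, Nat.succ x0, x1, x2, x3⟩) t fun t =>
    ifLe s1 j (g ⟨s0, j, s2, s3, x0, Nat.succ x1, x2, x3⟩) t fun t =>
    ifLe s2 j (g ⟨s0, s1, j, s3, x0, x1, Nat.succ x2, x3⟩) t fun t =>
    ifLe s3 j (g ⟨s0, s1, s2, j, x0, x1, x2, Nat.succ x3⟩) t k) q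

/-- `g` inserts a family of states such that the values of each `F n` sum up to `G n`. -/
def Adds {ι : Type} (F : ι → ScanState → ℕ)
    (g : ScanState → Trie → (Trie → Bool) → Bool)
    (G : ι → (Fin 4 → Fin 3) × (Fin 4 → ℕ) → ℕ) : Prop :=
  ∀ q t k, g q t k = true →
    ∃ t', (∀ n, t'.weight (F n) = t.weight (F n) + G n q.toPair) ∧ k t' = true

theorem ifLe_spec {ι : Type} {F : ι → ScanState → ℕ} {G : ι → ℕ} {t : Trie}
    {f : Trie → (Trie → Bool) → Bool} {k : Trie → Bool} {i j : Fin 3} (hf : f t k = true →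
      ∃ t', (∀ n, t'.weight (F n) = t.weight (F n) + G n) ∧ k t' = true)
    (h : ifLe i j f t k = true) :
    ∃ t', (∀ n, t'.weight (F n) = t.weight (F n) + if i ≤ j then G n else 0) ∧ k t' = true := by
  rw [ifLe, branchOn_eq_true, Nat.ble_eq, ← Fin.le_def] at h
  by_cases hij : i ≤ j
  · simpa only [hij, if_true] using hf (by simpa [hij] using h)
  · refine ⟨t, fun n => by simp [hij], ?_⟩
    simpa [hij] using h

theorem place_spec {ι : Type} {F : ι → ScanState → ℕ}
    {g : ScanState → Trie → (Trie → Bool) → Bool} {G : ι → (Fin 4 → Fin 3) × (Fin 4 → ℕ) → ℕ}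
    (hg : Adds F g G) (j : Fin 3) :
    Adds F (place j g) fun n p => ∑ k, if p.1 k ≤ j then G n (ScanState.put j k p) else 0 := by
  rintro ⟨s0, s1, s2, s3, x0, x1, x2, x3⟩ t k h
  obtain ⟨t, h0, h⟩ := ifLe_spec (hg _ _ _) h
  obtain ⟨t, h1, h⟩ := ifLe_spec (hg _ _ _) h
  obtain ⟨t, h2, h⟩ := ifLe_spec (hg _ _ _) h
  obtain ⟨t, h3, h⟩ := ifLe_spec (hg _ _ _) h
  refine ⟨t, fun n => ?_, h⟩
  beta_reduce
  rw [h3, h2, h1, h0, Fin.sum_univ_four]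
  have e : ∀ (a : Fin 4 → Fin 3) (b : Fin 4 → ℕ) (k : Fin 4), ScanState.put j k (a, b) =
    (Function.update a k j, Function.update b k (b k + 1)) := fun _ _ _ => rfl
  have e3 {α : Type} (a b c d x : α) : Function.update ![a, b, c, d] 3 x = ![a, b, c, x] := by
    ext i; fin_cases i <;> rfl
  have e2 {α : Type} (a b c d x : α) : Function.update ![a, b, c, d] 2 x = ![a, b, x, d] := by
    ext i; fin_cases i <;> rfl
  have e1 {α : Type} (a b c d x : α) : Function.update ![a, b, c, d] 1 x = ![a, x, c, d] := by
    ext i; fin_cases i <;> rfl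
  have e0 {α : Type} (a b c d x : α) : Function.update ![a, b, c, d] 0 x = ![x, b, c, d] := by
    ext i; fin_cases i <;> rfl
  simp [ScanState.toPair, ScanState.rows, ScanState.shortfalls, e, e0, e1, e2, e3, add_assoc]

/-- Ends a column and inserts the resulting state `c` times, if it is feasible. -/
noncomputable def close (c : ℕ) (q : ScanState) (t : Trie) (k : Trie → Bool) : Bool :=
  ScanState.rec (fun s0 s1 s2 s3 x0 x1 x2 x3 =>
    branchOn (Nat.ble (Nat.succ s0.val) x0) (branchOn (Nat.ble (Nat.succ s1.val) x1)
      (branchOn (Nat.ble (Nat.succ s2.val) x2) (branchOn (Nat.ble x3 4)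
        (force (Nat.pred x0) fun x0 => force (Nat.pred x1) fun x1 => force (Nat.pred x2) fun x2 =>
          force x3 fun x3 => force (ScanState.key ⟨s0, s1, s2, s3, x0, x1, x2, x3⟩) fun h =>
          ins ⟨s0, s1, s2, s3, x0, x1, x2, x3⟩ c h 6 t k) (k t)) (k t)) (k t)) (k t)) q

theorem close_mk (c : ℕ) (s0 s1 s2 s3 : Fin 3) (x0 x1 x2 x3 : ℕ) (t : Trie) (k : Trie → Bool) :
    close c ⟨s0, s1, s2, s3, x0, x1, x2, x3⟩ t k =
    branchOn (Nat.ble (Nat.succ s0.val) x0) (branchOn (Nat.ble (Nat.succ s1.val) x1)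
      (branchOn (Nat.ble (Nat.succ s2.val) x2) (branchOn (Nat.ble x3 4)
        (force (Nat.pred x0) fun x0 => force (Nat.pred x1) fun x1 => force (Nat.pred x2) fun x2 =>
          force x3 fun x3 => force (ScanState.key ⟨s0, s1, s2, s3, x0, x1, x2, x3⟩) fun h =>
          ins ⟨s0, s1, s2, s3, x0, x1, x2, x3⟩ c h 6 t k) (k t)) (k t)) (k t)) (k t) := rfl

def closeValue {α : Type} (F : α → (Fin 4 → Fin 3) → (Fin 4 → ℕ) → ℕ) (n : α)
    (p : (Fin 4 → Fin 3) × (Fin 4 → ℕ)) : ℕ :=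
  if Feasible p.1 p.2 then F n p.1 fun k => p.2 k - unitQuota k else 0

theorem close_spec {ι : Type} (F : ι → (Fin 4 → Fin 3) → (Fin 4 → ℕ) → ℕ) (c : ℕ) :
    Adds (fun n q => F n q.rows q.shortfalls) (close c) fun n p => c * closeValue F n p := by
  rintro ⟨s0, s1, s2, s3, x0, x1, x2, x3⟩ t k h
  have hf : Feasible ![s0, s1, s2, s3] ![x0, x1, x2, x3] ↔
      s0.val < x0 ∧ s1.val < x1 ∧ s2.val < x2 ∧ x3 ≤ 4 := by
    simp [Feasible, Fin.forall_fin_succ]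
  have hx : (fun k => ![x0, x1, x2, x3] k - unitQuota k) = ![x0 - 1, x1 - 1, x2 - 1, x3] := by
    ext i; fin_cases i <;> rfl
  simp only [ScanState.toPair, ScanState.rows, ScanState.shortfalls, closeValue, hx]
  rw [close_mk] at h
  simp only [force_eq, branchOn_eq_true, Nat.ble_eq, Nat.succ_le_iff] at h
  by_cases hF : Feasible ![s0, s1, s2, s3] ![x0, x1, x2, x3]
  · simp only [hF, if_true]
    obtain ⟨h0, h1, h2, h3⟩ := hf.1 hF
    obtain ⟨t', ht, hk⟩ := ins_spec _ _ _ _ _ _ (by simpa [h0, h1, h2, h3] using h)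
    exact ⟨t', fun n => ht fun q => F n q.rows q.shortfalls, hk⟩
  · refine ⟨t, fun n => by simp [hF], ?_⟩
    rw [hf] at hF
    tauto

/-- Inserts, `c` times each, the states reached from a state by reading a column. -/
noncomputable def column (c : ℕ) : ScanState → Trie → (Trie → Bool) → Bool :=
  place 0 (place 1 (place 2 (close c)))

-- The column is read cell by cell. Testing against rows already updated within the column agrees
-- with `FitsRows`, since a colour reused in the column was last put into a lower row, which passes
-- both tests.
open ScanState in
theorem scanCount_succ_eq (n : ℕ) (s : Fin 4 → Fin 3) (x : Fin 4 → ℕ) :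
    scanCount (n + 1) s x =
      ∑ k0, if s k0 ≤ 0 then ∑ k1, if (put 0 k0 (s, x)).1 k1 ≤ 1 then
        ∑ k2, if (put 1 k1 (put 0 k0 (s, x))).1 k2 ≤ 2 then
          closeValue scanCount n (put 2 k2 (put 1 k1 (put 0 k0 (s, x)))) else 0 else 0 else 0 := by
  let e : (Fin 3 → Fin 4) ≃ Fin 4 × Fin 4 × Fin 4 :=
    ⟨fun a => (a 0, a 1, a 2), fun t => ![t.1, t.2.1, t.2.2],
      fun a => by ext i; fin_cases i <;> rfl, fun t => rfl⟩
  rw [scanCount_succ, ← e.symm.sum_comp, Fintype.sum_prod_type]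
  refine Finset.sum_congr rfl fun k0 _ => ?_
  rw [Fintype.sum_prod_type]
  have key : ∀ k1 k2,
      (if FitsRows s (e.symm (k0, k1, k2)) ∧ Feasible (raiseRows s (e.symm (k0, k1, k2)))
          (fun k => x k + colMult (e.symm (k0, k1, k2)) k) then
        scanCount n (raiseRows s (e.symm (k0, k1, k2)))
          (fun k => x k + colMult (e.symm (k0, k1, k2)) k - unitQuota k) else 0) =
      if s k0 ≤ 0 then if (put 0 k0 (s, x)).1 k1 ≤ 1 then
        if (put 1 k1 (put 0 k0 (s, x))).1 k2 ≤ 2 then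
          closeValue scanCount n (put 2 k2 (put 1 k1 (put 0 k0 (s, x)))) else 0 else 0 else 0 := by
    intro k1 k2
    have hc : (fun k => x k + colMult (e.symm (k0, k1, k2)) k) =
        (put 2 k2 (put 1 k1 (put 0 k0 (s, x)))).2 := by
      ext k
      change x k + colMult ![k0, k1, k2] k = _
      rw [colMult, Finset.card_filter, Fin.sum_univ_three]
      simp only [put_snd, Matrix.cons_val, add_assoc]
      rfl
    have hr : raiseRows s (e.symm (k0, k1, k2)) = (put 2 k2 (put 1 k1 (put 0 k0 (s, x)))).1 := rfl
    have hfit : FitsRows s (e.symm (k0, k1, k2)) ↔ s k0 ≤ 0 ∧ (put 0 k0 (s, x)).1 k1 ≤ 1 ∧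
        (put 1 k1 (put 0 k0 (s, x))).1 k2 ≤ 2 := by
      change (∀ j, s (![k0, k1, k2] j) ≤ j) ↔ _
      simp only [Fin.forall_fin_succ, put, Function.update_apply]
      split_ifs <;> simp_all [Fin.le_def]
      omega
    have hv : ∀ k, x k + colMult (e.symm (k0, k1, k2)) k = _ := congrFun hc
    simp only [hr, hfit, hv, closeValue, ite_and]
  simp only [key]
  split_ifs
  · refine Finset.sum_congr rfl fun k1 _ => ?_
    split_ifs
    · rfl
    · simp
  · simp

theorem column_spec (c : ℕ) :
    Adds (fun n q => scanCount n q.rows q.shortfalls) (column c)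
      fun n p => c * scanCount (n + 1) p.1 p.2 := by
  have h := place_spec (place_spec (place_spec (close_spec scanCount c) 2) 1) 0
  intro q t k hk
  obtain ⟨t', ht, hk⟩ := h q t k hk
  refine ⟨t', fun n => ?_, hk⟩
  refine (ht n).trans (congrArg _ ?_)
  simp only [scanCount_succ_eq, Finset.mul_sum, mul_ite, mul_zero]

noncomputable def stepBucket (b : Bucket) : Trie → (Trie → Bool) → Bool :=
  Bucket.rec (fun t k => k t) (fun _ q c _ ih t k => column c q t fun t => ih t k) b

/-- Inserts the states reached from those of a trie by reading a column. -/
noncomputable def step (t : Trie) : Trie → (Trie → Bool) → Bool :=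
  Trie.rec (fun t k => k t) stepBucket (fun _ _ ihl ihr t k => ihl t fun t => ihr t k) t

theorem stepBucket_spec (b : Bucket) : ∀ t k, stepBucket b t k = true →
    ∃ t', (∀ n, t'.weight (fun q => scanCount n q.rows q.shortfalls) =
      t.weight (fun q => scanCount n q.rows q.shortfalls) +
      b.weight (fun q => scanCount (n + 1) q.rows q.shortfalls)) ∧ k t' = true := by
  induction b with
  | nil => exact fun t k hk => ⟨t, fun n => by simp [Bucket.weight], hk⟩
  | cons h q c b ih =>
    intro t k hk
    obtain ⟨t1, h1, hk⟩ := column_spec c q t _ hk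
    obtain ⟨t2, h2, hk⟩ := ih _ _ hk
    exact ⟨t2, fun n => by rw [h2, h1, Bucket.weight, add_assoc]; rfl, hk⟩

theorem step_spec (u : Trie) : ∀ t k, step u t k = true →
    ∃ t', (∀ n, t'.weight (fun q => scanCount n q.rows q.shortfalls) =
      t.weight (fun q => scanCount n q.rows q.shortfalls) +
      u.weight (fun q => scanCount (n + 1) q.rows q.shortfalls)) ∧ k t' = true := by
  induction u with
  | nil => exact fun t k hk => ⟨t, fun n => by simp [weight], hk⟩
  | leaf b => exact stepBucket_spec b
  | node l r ihl ihr =>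
    intro t k hk
    obtain ⟨t1, h1, hk⟩ := ihl _ _ hk
    obtain ⟨t2, h2, hk⟩ := ihr _ _ hk
    exact ⟨t2, fun n => by rw [h2, h1, weight, add_assoc], hk⟩

noncomputable def acceptBucket (b : Bucket) : ℕ :=
  Bucket.rec 0 (fun _ q c _ ih => ScanState.rec (fun _ _ _ _ x0 x1 x2 x3 =>
    cond (Nat.beq x0 2 && (Nat.beq x1 2 && (Nat.beq x2 2 && Nat.beq x3 4))) (Nat.add c ih) ih)
    q) b

/-- The multiplicity of the final states. -/
noncomputable def accept (t : Trie) : ℕ :=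
  Trie.rec 0 acceptBucket (fun _ _ a b => Nat.add a b) t

theorem acceptBucket_eq (b : Bucket) :
    acceptBucket b = b.weight fun q => scanCount 0 q.rows q.shortfalls := by
  induction b with
  | nil => rfl
  | cons h q c b ih =>
    obtain ⟨s0, s1, s2, s3, x0, x1, x2, x3⟩ := q
    rw [Bucket.weight, ← ih, scanCount_zero]
    change cond (Nat.beq x0 2 && (Nat.beq x1 2 && (Nat.beq x2 2 && Nat.beq x3 4)))
      (Nat.add c (acceptBucket b)) (acceptBucket b) = _
    have : ScanState.shortfalls ⟨s0, s1, s2, s3, x0, x1, x2, x3⟩ = quota 0 ↔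
        (Nat.beq x0 2 && (Nat.beq x1 2 && (Nat.beq x2 2 && Nat.beq x3 4))) = true := by
      simp [funext_iff, Fin.forall_fin_succ, ScanState.shortfalls, quota]
    rw [if_congr this rfl rfl, Bool.cond_eq_ite]
    split_ifs <;> simp

theorem accept_eq (t : Trie) :
    accept t = t.weight fun q => scanCount 0 q.rows q.shortfalls := by
  induction t with
  | nil => rfl
  | leaf b => exact acceptBucket_eq b
  | node l r ihl ihr => rw [weight, ← ihl, ← ihr]; rfl

/-- The numbers of scan colourings of `0, 1, …` columns that start at the states of `t` are those
of a list. -/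
noncomputable def check : List ℕ → Trie → Bool
  | [], _ => true
  | v :: vs, t => Nat.beq t.accept v && step t nil (check vs)

theorem weight_of_check (vs : List ℕ) : ∀ t, check vs t = true → ∀ n (h : n < vs.length),
    t.weight (fun q => scanCount n q.rows q.shortfalls) = vs[n] := by
  induction vs with
  | nil => exact fun t _ n h => absurd h (Nat.not_lt_zero n)
  | cons v vs ih =>
    intro t ht n h
    rw [check, Bool.and_eq_true, Nat.beq_eq] at ht
    cases n with
    | zero => rw [← accept_eq, ht.1]; rfl
    | succ n =>
      obtain ⟨t', ht', hk⟩ := step_spec _ _ _ ht.2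
      simpa [weight, ih t' hk n (Nat.lt_of_succ_lt_succ h)] using (ht' n).symm

/-- The trie with a single state, at which no cell has been read. -/
def start (x0 x1 x2 : ℕ) : Trie :=
  let t := leaf (.cons 0 ⟨0, 0, 0, 0, x0, x1, x2, 0⟩ 1 .nil)
  node (node (node (node (node (node t nil) nil) nil) nil) nil) nil

end Trie

/-- Only the entries at 11 to 15 are used later; the earlier ones are passed on the way. -/
theorem check_start_046 :
    Trie.check [0, 0, 0, 0, 6, 106, 438, 998, 1760, 2964, 4764, 7338, 10888,
      15640, 21844, 29774] (Trie.start 0 4 6) = true := by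
  decide +kernel

theorem check_start_055 :
    Trie.check [0, 0, 0, 0, 24, 184, 636, 1332, 2216, 3558, 5510, 8248, 11972,
      16906, 23298, 31420] (Trie.start 0 5 5) = true := by
  decide +kernel

theorem scanCount_of_check {vs : List ℕ} {x0 x1 x2 : ℕ}
    (h : Trie.check vs (Trie.start x0 x1 x2) = true) (n : ℕ) (hn : n < vs.length) :
    scanCount n (fun _ => 0) ![x0, x1, x2, 0] = vs[n] := by
  have hr : ScanState.rows ⟨0, 0, 0, 0, x0, x1, x2, 0⟩ = fun _ => 0 := by
    ext i; fin_cases i <;> rfl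
  rw [← Trie.weight_of_check vs _ h n hn]
  simp [Trie.start, Trie.weight, Bucket.weight, hr, ScanState.shortfalls]

theorem scanCount_eq_of_evPoly {x : Fin 4 → ℕ} (hx : x 3 = 0) {P : ℕ → ℤ} (hP : EvPoly 5 11 P)
    (h : ∀ i < 5, 3 * (scanCount (11 + i) (fun _ => 0) x : ℤ) = P (11 + i)) (n : ℕ)
    (hn : 11 ≤ n) : 3 * (scanCount n (fun _ => 0) x : ℤ) = P n := by
  have h0 : EvPoly 5 11 fun n => (scanCount n (fun _ => 0) x : ℤ) := by
    -- Initially four cells of the last colour and six row steps are available, so `N = 4 + 6`.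
    simpa [rowSum, hx] using evPoly_scanCount 10 (fun _ => 0) x (by omega) (by simp [rowSum, hx])
  have := ((h0.const_mul 3).add (hP.const_mul (-1))).eq_zero
    (fun i hi => by rw [h i hi]; ring) n hn
  linarith

theorem three_mul_scanCount_046 (n : ℕ) (hn : 11 ≤ n) :
    3 * (scanCount n (fun _ => 0) ![0, 4, 6, 0] : ℤ) =
      3 * (n : ℤ) ^ 4 - 25 * n ^ 3 + 108 * n ^ 2 - 194 * n + 432 := by
  refine scanCount_eq_of_evPoly rfl
    (P := fun n => 3 * (n : ℤ) ^ 4 - 25 * n ^ 3 + 108 * n ^ 2 - 194 * n + 432)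
    (fun n _ => ?_) (fun i hi => ?_) n hn
  · push_cast
    ring
  · rw [scanCount_of_check check_start_046 (11 + i) (by simp; omega)]
    interval_cases i <;> norm_num

theorem three_mul_scanCount_055 (n : ℕ) (hn : 11 ≤ n) :
    3 * (scanCount n (fun _ => 0) ![0, 5, 5, 0] : ℤ) =
      3 * (n : ℤ) ^ 4 - 26 * n ^ 3 + 156 * n ^ 2 - 379 * n + 720 := by
  refine scanCount_eq_of_evPoly rfl
    (P := fun n => 3 * (n : ℤ) ^ 4 - 26 * n ^ 3 + 156 * n ^ 2 - 379 * n + 720)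
    (fun n _ => ?_) (fun i hi => ?_) n hn
  · push_cast
    ring
  · rw [scanCount_of_check check_start_055 (11 + i) (by simp; omega)]
    interval_cases i <;> norm_num

/-! ### From stable compositions to scan colourings -/

/-- Stable compositions, as vertex colourings. -/
def stableColorings {V : Type*} (G : SimpleGraph V) (τ : List ℕ) : Set (V → Fin τ.length) :=
  {c | ∀ i, G.IsIndepSet {v | c v = i} ∧ Nat.card {v // c v = i} = τ.get i}

theorem stc_eq_ncard_stableColorings {V : Type*} [Finite V] (G : SimpleGraph V) (τ : List ℕ) :
    stc G τ = (stableColorings G τ).ncard := by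
  classical
  have := Fintype.ofFinite V
  let φ (c : V → Fin τ.length) (i : Fin τ.length) : Finset V := {v | c v = i}
  have hφ : Function.Injective φ := fun c d h => funext fun v => by
    have : v ∈ φ d (c v) := h ▸ by simp [φ]
    exact ((by simpa [φ] using this : d v = c v)).symm
  rw [stc, ← Set.ncard_image_of_injective _ hφ]
  congr 1
  ext B
  constructor
  · rintro ⟨h1, h2⟩
    choose c hc hu using h1
    have hB : φ c = B := funext fun i => Finset.ext fun v => by
      simp only [φ, Finset.mem_filter_univ]
      exact ⟨fun h => h ▸ hc v, fun h => (hu v i h).symm⟩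
    refine ⟨c, fun i => ?_, hB⟩
    have := h2 i
    rw [← hB] at this
    simpa [φ, Fintype.card_subtype] using this
  · rintro ⟨c, hc, rfl⟩
    refine ⟨fun v => ⟨c v, by simp [φ], fun i hi => by simpa [φ, eq_comm] using hi⟩, fun i => ?_⟩
    simpa [φ, Fintype.card_subtype] using hc i

theorem isIndepSet_incChainProd {m n : ℕ} {B : Set (Fin m × Fin n)} :
    (incChainProd m n).IsIndepSet B ↔ ∀ v ∈ B, ∀ w ∈ B, v.1 < w.1 → v.2 ≤ w.2 := by
  constructor
  · intro h v hv w hw hlt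
    by_contra hle
    exact h hv hw (fun h => hlt.ne (congrArg Prod.fst h))
      ⟨fun h => hle h.2, fun h => hlt.not_ge h.1⟩
  · rintro h v hv w hw - ⟨h1, h2⟩
    simp only [Prod.le_def] at h1 h2
    obtain hlt | he | hlt := lt_trichotomy v.1 w.1
    · exact h1 ⟨hlt.le, h v hv w hw hlt⟩
    · obtain hle | hle := le_total v.2 w.2
      · exact h1 ⟨he.le, hle⟩
      · exact h2 ⟨he.ge, hle⟩
    · exact h2 ⟨hlt.le, h w hw v hv hlt⟩

theorem chainClasses_iff {m : ℕ} (c : Fin m → Fin 3 → Fin 4) :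
    ChainClasses c ↔ ∀ k, (incChainProd m 3).IsIndepSet {v | c v.1 v.2 = k} := by
  simp only [isIndepSet_incChainProd, ChainClasses, Set.mem_ofPred_eq, Prod.forall]
  exact ⟨fun h k x i hx y j hy hlt => h x y hlt i j (hx.trans hy.symm),
    fun h x y hlt i j he => h _ x i he y j rfl hlt⟩

theorem classSize_eq_card {m : ℕ} (c : Fin m → Fin 3 → Fin 4) (k : Fin 4) :
    classSize c k = Nat.card {v : Fin m × Fin 3 // c v.1 v.2 = k} := by
  rw [Nat.card_eq_fintype_card, Fintype.card_subtype, Finset.card_filter, Fintype.sum_prod_type]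
  simp only [classSize, colMult, Finset.card_filter]

theorem stc_incChainProd_three {m a b c d : ℕ} {x : Fin 4 → ℕ} (ha : a + x 0 = m + 2)
    (hb : b + x 1 = m + 2) (hc : c + x 2 = m + 2) (hd : d + x 3 = 4) :
    stc (incChainProd m 3) [a, b, c, d] = scanCount m (fun _ => 0) x := by
  classical
  have key : ∀ f : Fin m × Fin 3 → Fin 4, f ∈ stableColorings (incChainProd m 3) [a, b, c, d] ↔
      IsScanColoring (fun _ => 0) x (Function.curry f) := by
    intro f
    have hq : ∀ k : Fin 4, quota m k = [a, b, c, d].get k + x k := by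
      simp [Fin.forall_fin_succ, quota, ha, hb, hc, hd]
    have hfit : ∀ i, FitsRows (fun _ => 0) (Function.curry f i) := fun i j => Fin.zero_le _
    rw [IsScanColoring, chainClasses_iff]
    simp only [hfit, implies_true, true_and, hq, Nat.add_right_cancel_iff, classSize_eq_card]
    exact forall_and
  rw [stc_eq_ncard_stableColorings, scanCount, Set.ncard_eq_toFinset_card', ← Finset.card_filter]
  refine Finset.card_equiv (Equiv.curry _ _ _) fun f => ?_
  simp [key]

/-! ### Removing the minimum and the maximum -/

theorem isBot_iff_rank {m n : ℕ} (v : Fin (m + 1) × Fin (n + 1)) :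
    IsBot v ↔ (v.1 : ℕ) + v.2 = 0 := by
  constructor
  · intro h
    have := h (0, 0)
    simp [Prod.le_def] at this
    simp [this]
  · intro h w
    rw [Prod.le_def, Fin.le_def, Fin.le_def]
    omega

theorem isTop_iff_rank {m n : ℕ} (v : Fin (m + 1) × Fin (n + 1)) :
    IsTop v ↔ (v.1 : ℕ) + v.2 = m + n := by
  constructor
  · intro h
    have := h (Fin.last m, Fin.last n)
    rw [Prod.le_def, Fin.le_def, Fin.le_def] at this
    simp only [Fin.val_last] at this
    omega
  · intro h w
    rw [Prod.le_def, Fin.le_def, Fin.le_def]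
    omega

/-- A stable set of the largest possible size is a maximal chain, so that it contains the minimum
and the maximum. -/
theorem mem_of_isIndepSet_of_card {m n : ℕ} {B : Finset (Fin (m + 1) × Fin (n + 1))}
    (hB : (incChainProd (m + 1) (n + 1)).IsIndepSet B) (hc : B.card = m + n + 1)
    (v : Fin (m + 1) × Fin (n + 1)) (hv : IsBot v ∨ IsTop v) : v ∈ B := by
  rw [isIndepSet_incChainProd] at hB
  let r (w : Fin (m + 1) × Fin (n + 1)) : ℕ := w.1 + w.2
  have hinj : Set.InjOn r B := by
    intro v hv w hw h
    have h1 := hB v hv w hw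
    have h2 := hB w hw v hv
    simp only [r, Fin.lt_def, Fin.le_def] at *
    ext <;> omega
  have himg : B.image r = Finset.range (m + n + 1) := by
    refine Finset.eq_of_subset_of_card_le (fun i hi => ?_) ?_
    · obtain ⟨w, -, rfl⟩ := Finset.mem_image.1 hi
      simp only [r, Finset.mem_range]
      omega
    · rw [Finset.card_image_of_injOn hinj, hc, Finset.card_range]
  have hr : r v ∈ B.image r := by
    rw [himg, Finset.mem_range]
    simp only [r]
    omega
  obtain ⟨w, hw, he⟩ := Finset.mem_image.1 hr
  rw [isBot_iff_rank, isTop_iff_rank] at hv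
  have : w = v := by
    simp only [r] at he
    ext <;> omega
  exact this ▸ hw

open Classical in
theorem card_not_inner {m n : ℕ} (h : 0 < m + n) :
    #{v : Fin (m + 1) × Fin (n + 1) | ¬ (¬ IsBot v ∧ ¬ IsTop v)} = 2 := by
  rw [show ({v | ¬ (¬ IsBot v ∧ ¬ IsTop v)} : Finset (Fin (m + 1) × Fin (n + 1))) =
    {(0, 0), (Fin.last m, Fin.last n)} from ?_]
  · refine Finset.card_pair fun he => ?_
    simp only [Prod.mk.injEq, Fin.ext_iff, Fin.val_zero, Fin.val_last] at he
    omega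
  · ext v
    rw [Finset.mem_filter_univ, isBot_iff_rank, isTop_iff_rank, Finset.mem_insert,
      Finset.mem_singleton, Prod.ext_iff, Prod.ext_iff, Fin.ext_iff, Fin.ext_iff, Fin.ext_iff,
      Fin.ext_iff]
    simp only [Fin.val_zero, Fin.val_last]
    omega

theorem card_innerVertex {m n : ℕ} (h : 0 < m + n) :
    Nat.card (InnerVertex (m + 1) (n + 1)) = (m + 1) * (n + 1) - 2 := by
  classical
  rw [Nat.card_eq_fintype_card, Fintype.card_subtype]
  have := Finset.card_filter_add_card_filter_not (s := univ)
    (fun v : Fin (m + 1) × Fin (n + 1) => ¬ IsBot v ∧ ¬ IsTop v)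
  rw [card_not_inner h] at this
  simp only [Finset.card_univ, Fintype.card_prod, Fintype.card_fin] at this
  omega

/-- The minimum and the maximum are comparable to everything, hence isolated vertices. -/
theorem isIndepSet_innerGraph {m n : ℕ} {B : Set (Fin m × Fin n)} :
    (incChainProd m n).IsIndepSet B ↔ (innerGraph m n).IsIndepSet (Subtype.val ⁻¹' B) := by
  constructor
  · intro h v hv w hw hne
    exact h hv hw fun he => hne (Subtype.ext he)
  · intro h v hv w hw hne hadj
    have hin : ∀ {v w}, (incChainProd m n).Adj v w → ¬ IsBot v ∧ ¬ IsTop v := fun hadj =>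
      ⟨fun hb => hadj.1 (hb _), fun ht => hadj.2 (ht _)⟩
    exact h (x := ⟨v, hin hadj⟩) hv (y := ⟨w, hin hadj.symm⟩) hw
      (fun he => hne (congrArg Subtype.val he)) hadj

/-- A first block of size `m + n + 1` is a maximal chain and must contain both extreme elements.
Restriction is therefore a bijection, inverted by giving these two elements the colour 0. -/
theorem stc_innerGraph {m n : ℕ} (h : 0 < m + n) (τ : List ℕ) :
    stc (innerGraph (m + 1) (n + 1)) ((m + n - 1) :: τ) =
      stc (incChainProd (m + 1) (n + 1)) ((m + n + 1) :: τ) := by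
  classical
  rw [stc_eq_ncard_stableColorings, stc_eq_ncard_stableColorings]
  have hcard : ∀ (c : Fin (m + 1) × Fin (n + 1) → Fin (τ.length + 1)),
      (∀ v, ¬ (¬ IsBot v ∧ ¬ IsTop v) → c v = 0) → ∀ i, Nat.card {v // c v = i} =
        Nat.card {v : InnerVertex (m + 1) (n + 1) // c v.1 = i} + if i = 0 then 2 else 0 := by
    intro c hc i
    have h1 : Nat.card {v : InnerVertex (m + 1) (n + 1) // c v.1 = i} =
        #{v | c v = i ∧ (¬ IsBot v ∧ ¬ IsTop v)} := by
      rw [← Fintype.card_subtype, ← Nat.card_eq_fintype_card]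
      exact Nat.card_congr ((Equiv.subtypeSubtypeEquivSubtypeInter _ fun v => c v = i).trans
        (Equiv.subtypeEquivRight fun v => and_comm))
    have h2 : #{v | c v = i ∧ ¬ (¬ IsBot v ∧ ¬ IsTop v)} = if i = 0 then 2 else 0 := by
      split_ifs with hi
      · rw [← card_not_inner h]
        congr 1
        ext v
        simp only [Finset.mem_filter_univ, hi]
        exact and_iff_right_of_imp (hc v)
      · rw [Finset.card_eq_zero, Finset.filter_eq_empty_iff]
        exact fun v _ hv => hi (hv.1.symm.trans (hc v hv.2))
    have h3 := Finset.card_filter_add_card_filter_not (s := {v | c v = i})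
      fun v => ¬ IsBot v ∧ ¬ IsTop v
    rw [Finset.filter_filter, Finset.filter_filter] at h3
    rw [h1, ← h2, Nat.card_eq_fintype_card, Fintype.card_subtype, h3]
  have hget : ∀ i : Fin (τ.length + 1), ((m + n + 1) :: τ).get i =
      ((m + n - 1) :: τ).get i + if i = 0 then 2 else 0 := by
    intro i
    cases i using Fin.cases with
    | zero => simp; omega
    | succ i => simp
  have hzero : ∀ c ∈ stableColorings (incChainProd (m + 1) (n + 1)) ((m + n + 1) :: τ),
      ∀ v, ¬ (¬ IsBot v ∧ ¬ IsTop v) → c v = (0 : Fin (τ.length + 1)) := by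
    intro c hc v hv
    have h0 := hc (0 : Fin (τ.length + 1))
    have := mem_of_isIndepSet_of_card (B := {v | c v = (0 : Fin (τ.length + 1))})
      (by simpa using h0.1) (by simpa [Fintype.card_subtype] using h0.2) v (by tauto)
    simpa using this
  have hmem : ∀ c : Fin (m + 1) × Fin (n + 1) → Fin (τ.length + 1),
      (∀ v, ¬ (¬ IsBot v ∧ ¬ IsTop v) → c v = 0) →
      (c ∈ stableColorings (incChainProd (m + 1) (n + 1)) ((m + n + 1) :: τ) ↔
        (fun v : InnerVertex (m + 1) (n + 1) => c v.1) ∈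
          stableColorings (innerGraph (m + 1) (n + 1)) ((m + n - 1) :: τ)) := by
    intro c hc
    refine forall_congr' fun i => and_congr isIndepSet_innerGraph ?_
    change Nat.card {v // c v = i} = ((m + n + 1) :: τ).get i ↔ _
    rw [hcard c hc, hget, Nat.add_right_cancel_iff]
  symm
  refine Set.ncard_congr (fun c _ v => c v.1) (fun c hc => (hmem c (hzero c hc)).1 hc)
    (fun c d hc hd he => funext fun v => ?_) fun c hc => ?_
  · by_cases hv : ¬ IsBot v ∧ ¬ IsTop v
    · exact congrFun he ⟨v, hv⟩
    · exact (hzero c hc v hv).trans (hzero d hd v hv).symm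
  · let e (v : Fin (m + 1) × Fin (n + 1)) : Fin (τ.length + 1) :=
      if hv : ¬ IsBot v ∧ ¬ IsTop v then c ⟨v, hv⟩ else 0
    have he : (fun v : InnerVertex (m + 1) (n + 1) => e v.1) = c :=
      funext fun v => dif_pos v.2
    exact ⟨e, (hmem e fun v hv => dif_neg hv).2 (he.symm ▸ hc), he⟩

/-! ### Dominance and the main theorem -/

/-- The partition with a given weakly decreasing list of positive parts. -/
theorem exists_partition {N : ℕ} (l : List ℕ) (hl : l.Pairwise (· ≥ ·)) (hpos : ∀ i ∈ l, 0 < i)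
    (hsum : l.sum = N) : ∃ p : N.Partition, partsList p = l :=
  ⟨⟨l, fun hi => hpos _ (by simpa using hi), by simpa using hsum⟩, by
    simpa [partsList] using List.mergeSort_of_pairwise (by simpa using hl)⟩

theorem exists_dominating_partitions {N a b c d : ℕ} (hab : b + 2 ≤ a) (hbc : c = b + 1)
    (hcd : d + 1 ≤ b - 1) (hd : 0 < d) (hN : a + c + (b - 1) + d = N) :
    ∃ p q : N.Partition, partsList p = [a, c, b - 1, d] ∧ partsList q = [a, b, b, d] ∧
      Dominates p q ∧ p ≠ q := by
  obtain ⟨p, hp⟩ := exists_partition (N := N) [a, c, b - 1, d] (by simp; omega)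
    (by simp; omega) (by simp; omega)
  obtain ⟨q, hq⟩ := exists_partition (N := N) [a, b, b, d] (by simp; omega)
    (by simp; omega) (by simp; omega)
  refine ⟨p, q, hp, hq, fun k => ?_, fun h => ?_⟩
  · rw [hp, hq]
    rcases k with _ | _ | _ | _ | k <;> simp <;> omega
  · rw [h, hq] at hp
    simp at hp
    omega

theorem not_stronglyNice {V : Type*} [Finite V] {G : SimpleGraph V} {N : ℕ} {l l' : List ℕ}
    (hN : Nat.card V = N) (h : ∃ p q : N.Partition, partsList p = l ∧ partsList q = l' ∧
      Dominates p q ∧ p ≠ q) (hlt : stc G l' < stc G l) : ¬ StronglyNice G := by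
  subst hN
  obtain ⟨p, q, rfl, rfl, hd, -⟩ := h
  exact fun hs => hlt.not_ge (hs p q hd)

theorem mainTheorem3 (m : ℕ) (hm : 44 ≤ m) :
    -- neither graph is strongly nice
    ¬ StronglyNice (incChainProd m 3) ∧
    ¬ StronglyNice (innerGraph m 3) ∧
    -- the four counts
    (stc (incChainProd m 3) [m + 2, m - 2, m - 4, 4] : ℚ)
      = (m : ℚ) ^ 4 - 25 / 3 * (m : ℚ) ^ 3 + 36 * (m : ℚ) ^ 2 - 194 / 3 * (m : ℚ) + 144 ∧
    (stc (innerGraph m 3) [m, m - 2, m - 4, 4] : ℚ)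
      = (m : ℚ) ^ 4 - 25 / 3 * (m : ℚ) ^ 3 + 36 * (m : ℚ) ^ 2 - 194 / 3 * (m : ℚ) + 144 ∧
    (stc (incChainProd m 3) [m + 2, m - 3, m - 3, 4] : ℚ)
      = (m : ℚ) ^ 4 - 26 / 3 * (m : ℚ) ^ 3 + 52 * (m : ℚ) ^ 2 - 379 / 3 * (m : ℚ) + 240 ∧
    (stc (innerGraph m 3) [m, m - 3, m - 3, 4] : ℚ)
      = (m : ℚ) ^ 4 - 26 / 3 * (m : ℚ) ^ 3 + 52 * (m : ℚ) ^ 2 - 379 / 3 * (m : ℚ) + 240 ∧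
    -- the first counts exceed the second ones
    stc (incChainProd m 3) [m + 2, m - 3, m - 3, 4]
      < stc (incChainProd m 3) [m + 2, m - 2, m - 4, 4] ∧
    stc (innerGraph m 3) [m, m - 3, m - 3, 4] < stc (innerGraph m 3) [m, m - 2, m - 4, 4] ∧
    -- although the first partitions strictly dominate the second ones
    (∃ p q : (3 * m).Partition, partsList p = [m + 2, m - 2, m - 4, 4] ∧
      partsList q = [m + 2, m - 3, m - 3, 4] ∧ Dominates p q ∧ p ≠ q) ∧
    (∃ p q : (3 * m - 2).Partition, partsList p = [m, m - 2, m - 4, 4] ∧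
      partsList q = [m, m - 3, m - 3, 4] ∧ Dominates p q ∧ p ≠ q) := by
  obtain ⟨k, rfl⟩ : ∃ k, m = k + 1 := ⟨m - 1, by omega⟩
  have hl := three_mul_scanCount_046 (k + 1) (by omega)
  have hu := three_mul_scanCount_055 (k + 1) (by omega)
  have hL : stc (incChainProd (k + 1) 3) [k + 1 + 2, k + 1 - 2, k + 1 - 4, 4] =
      scanCount (k + 1) (fun _ => 0) ![0, 4, 6, 0] :=
    stc_incChainProd_three (by simp) (by simp; omega) (by simp; omega) (by simp)
  have hU : stc (incChainProd (k + 1) 3) [k + 1 + 2, k + 1 - 3, k + 1 - 3, 4] =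
      scanCount (k + 1) (fun _ => 0) ![0, 5, 5, 0] :=
    stc_incChainProd_three (by simp) (by simp; omega) (by simp; omega) (by simp)
  have hi : ∀ τ, stc (innerGraph (k + 1) 3) ((k + 1) :: τ) =
      stc (incChainProd (k + 1) 3) ((k + 1 + 2) :: τ) := fun τ =>
    stc_innerGraph (m := k) (n := 2) (by omega) τ
  have hlt : scanCount (k + 1) (fun _ => 0) ![0, 5, 5, 0] <
      scanCount (k + 1) (fun _ => 0) ![0, 4, 6, 0] := by
    have hm' : (44 : ℤ) ≤ ((k + 1 : ℕ) : ℤ) := by exact_mod_cast hm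
    zify
    generalize ((k + 1 : ℕ) : ℤ) = t at *
    -- Three times the difference of the counts is `t ^ 3 - 48 * t ^ 2 + 185 * t - 288`, which is
    -- negative at 43. In terms of `u` it is `u ^ 3 + 84 * u ^ 2 + 1769 * u + 108`, with positive
    -- coefficients.
    obtain ⟨u, rfl⟩ : ∃ u, t = u + 44 := ⟨t - 44, by ring⟩
    have hu0 : 0 ≤ u := by linarith
    nlinarith [mul_nonneg hu0 hu0, mul_nonneg hu0 (mul_nonneg hu0 hu0)]
  have hlQ : (scanCount (k + 1) (fun _ => 0) ![0, 4, 6, 0] : ℚ) = ((k + 1 : ℕ) : ℚ) ^ 4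
      - 25 / 3 * ((k + 1 : ℕ) : ℚ) ^ 3 + 36 * ((k + 1 : ℕ) : ℚ) ^ 2
      - 194 / 3 * ((k + 1 : ℕ) : ℚ) + 144 := by
    qify at hl
    push_cast at hl ⊢
    linarith
  have huQ : (scanCount (k + 1) (fun _ => 0) ![0, 5, 5, 0] : ℚ) = ((k + 1 : ℕ) : ℚ) ^ 4
      - 26 / 3 * ((k + 1 : ℕ) : ℚ) ^ 3 + 52 * ((k + 1 : ℕ) : ℚ) ^ 2
      - 379 / 3 * ((k + 1 : ℕ) : ℚ) + 240 := by
    qify at hu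
    push_cast at hu ⊢
    linarith
  have hp := exists_dominating_partitions (N := 3 * (k + 1)) (a := k + 1 + 2) (b := k + 1 - 3)
    (c := k + 1 - 2) (d := 4) (by omega) (by omega) (by omega) (by omega) (by omega)
  have hp' := exists_dominating_partitions (N := 3 * (k + 1) - 2) (a := k + 1) (b := k + 1 - 3)
    (c := k + 1 - 2) (d := 4) (by omega) (by omega) (by omega) (by omega) (by omega)
  rw [(by omega : k + 1 - 3 - 1 = k + 1 - 4)] at hp hp'
  refine ⟨not_stronglyNice (by simp [mul_comm]) hp ?_, not_stronglyNice ?_ hp' ?_, ?_, ?_, ?_, ?_,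
    ?_, ?_, hp, hp'⟩
  · rwa [hL, hU]
  · exact (card_innerVertex (m := k) (n := 2) (by omega)).trans (by omega)
  · rwa [hi, hi, hL, hU]
  · rw [hL, hlQ]
  · rw [hi, hL, hlQ]
  · rw [hU, huQ]
  · rw [hi, hU, huQ]
  · rwa [hL, hU]
  · rwa [hi, hi, hL, hU]
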